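/- Let $K$ be a field, let $n\ge 0$ and $d\ge 1$ be integers, and let $f_1,\ldots,f_{n+1}\in K[x_1,\ldots,x_n]$ be polynomials of total degree $\deg f_i=d$ for all $i$. For an integer $D\ge 0$ let $K[x_1,\ldots,x_n]_{\le D}$ be the space of polynomials of total degree at most $D$, let $V_D$ be the $K$-linear span of all products $x_{j_1}\cdots x_{j_k}\cdot f_i$ with $1\le i\le n+1$, $j_1,\dots,j_k\in\{1,\dots,n\}$ and $k\ge 0$, $k+\deg f_i\le D$, and put $$\chi(D)=\dim_K K[x_1,\ldots,x_n]_{\le D}-\dim_K V_D .$$ Let $\binom{N}{k}_s$ denote the coefficient of $T^k$ in $(1+T+\cdots+T^s)^N$. Then $$\chi(D)\ \ge\ \binom{n+1}{D}_{d-1}\qquad\text{for every integer } D\ge 0.$$ Moreover, let $F_i\in K[x_0,x_1,\ldots,x_n]$ be the homogenization of $f_i$. If $F_1,\ldots,F_{n+1}$ is a generic system of forms of degree $d$ (that is, every monomial of degree $d$ in $x_0,\ldots,x_n$ has a non-zero coefficient in each $F_i$, and all these coefficients, of all the $F_i$ taken together, are algebraically independent over the prime field of $K$), then $$\chi(D)=\binom{n+1}{D}_{d-1}\qquad\text{for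 every integer } D\ge 0.$$ -/

import Mathlib

open MvPolynomial

noncomputable section

/-- The ordinary multinomial (generalized binomial coefficient of order `s`) `(N choose k)_s`:
the coefficient of `T ^ k` in `(1 + T + ⋯ + T ^ s) ^ N`. -/
def ordinaryMultinomial (N k s : ℕ) : ℕ :=
  ((∑ i ∈ Finset.range (s + 1), (Polynomial.X : Polynomial ℕ) ^ i) ^ N).coeff k

/-- The space `V_D` spanned by all products `x_{j_1} ⋯ x_{j_k} * f_i` of a monomial of degree `k`
with one of the given polynomials, where `k + deg (f_i) ≤ D`. -/
def xlSpace {K : Type*} [Field K] {n : ℕ} {ι : Type*}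
    (f : ι → MvPolynomial (Fin n) K) (D : ℕ) : Submodule K (MvPolynomial (Fin n) K) :=
  Submodule.span K {p | ∃ (i : ι) (m : Fin n →₀ ℕ),
    m.degree + (f i).totalDegree ≤ D ∧ p = monomial m (1 : K) * f i}

/-- The XL defect `χ(D) = dim K[x_1, …, x_n]_{≤ D} - dim V_D`. -/
def xlDefect {K : Type*} [Field K] {n : ℕ} {ι : Type*}
    (f : ι → MvPolynomial (Fin n) K) (D : ℕ) : ℤ :=
  (Module.finrank K (restrictTotalDegree (Fin n) K D) : ℤ) - Module.finrank K (xlSpace f D)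

/-- The homogenization `F = x_0 ^ deg f * f (x_1 / x_0, …, x_n / x_0)` of `f`. The new variable
`x_0` has index `0`, and the old variable with index `j` gets the index `j.succ`. -/
def homogenization {K : Type*} [Field K] {n : ℕ} (f : MvPolynomial (Fin n) K) :
    MvPolynomial (Fin (n + 1)) K :=
  ∑ m ∈ f.support, monomial (Finsupp.cons (f.totalDegree - m.degree) m) (coeff m f)

/-- A generic system of forms of degrees `d i`: every monomial of degree `d i` occurs in `G i` with
a non-zero coefficient, and the coefficients of all the forms together are algebraically
independent over the prime field of `K` (the smallest subfield `⊥`). -/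
structure IsGenericSystem {K : Type*} [Field K] {σ ι : Type*} (d : ι → ℕ)
    (G : ι → MvPolynomial σ K) : Prop where
  isHomogeneous : ∀ i, (G i).IsHomogeneous (d i)
  coeff_ne_zero : ∀ (i : ι) (m : σ →₀ ℕ), m.degree = d i → coeff m (G i) ≠ 0
  algebraicIndependent : AlgebraicIndependent (⊥ : Subfield K)
    (fun q : Σ i : ι, {m : σ →₀ ℕ // m.degree = d i} => coeff q.2.1 (G q.1))

end

/-! `dim V_D` is the rank of the Macaulay matrix, and every system is compared with the monomials
`1, x_1^d, …, x_n^d`, where `1` counts as a form of degree `d` (it dehomogenizes `x_0^d`). Let `r`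
be the number of distinct monomials among the products for this system. The exponents of degree at
most `D` that are missed are those with all `m j < d` and `D - deg m < d`; their number is the
multinomial coefficient. So the theorem says rank `≤ r` always, and rank `= r` for generic systems.

Rank can only drop under specialization. Since generic coefficients specialize to the powers, the
generic rank is at least `r`. Conversely, `f` specializes the universal system, whose Macaulay
matrix is annihilated by its Koszul matrix. The latter specializes to the Koszul matrix of the
powers, of rank at least `#rows - r`, so the universal rank is at most `r`
(`rank_macaulayMatrix_le`). -/

/-! ### Rank under specialization -/

open Matrix in
/-- A matrix of rank `r` over a field can be brought to the identity matrix of size `r`. -/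
theorem Matrix.exists_mul_mul_eq_one {k m n : Type*} [Field k] [Fintype m] [Fintype n]
    (A : Matrix m n k) :
    ∃ (P : Matrix (Fin A.rank) m k) (Q : Matrix n (Fin A.rank) k), P * A * Q = 1 := by
  classical
  let b : Module.Basis (Fin A.rank) k (LinearMap.range A.mulVecLin) := Module.finBasis k _
  choose q hq using fun i => (b i).2
  let Q : Matrix n (Fin A.rank) k := Matrix.of fun j i => q i j
  have hcol : ∀ i, A *ᵥ (Q *ᵥ Pi.single i 1) = (b i : m → k) := by
    intro i
    rw [← hq i, Matrix.mulVec_single_one]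
    rfl
  have hinj : LinearMap.ker (A * Q).mulVecLin = ⊥ := by
    rw [LinearMap.ker_eq_bot']
    intro v hv
    have hv' : ∑ i, v i • (b i : m → k) = 0 := by
      rw [← hv, Matrix.mulVecLin_apply, ← Matrix.mulVec_mulVec]
      conv_rhs => rw [pi_eq_sum_univ' v]
      simp only [Matrix.mulVec_sum, Matrix.mulVec_smul, hcol]
    have hb := b.linearIndependent.map' (Submodule.subtype _) (Submodule.ker_subtype _)
    funext i
    exact Fintype.linearIndependent_iff.1 hb v hv' i
  obtain ⟨g, hg⟩ := LinearMap.exists_leftInverse_of_injective _ hinj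
  refine ⟨LinearMap.toMatrix' g, Q, ?_⟩
  have hAQ := LinearMap.toMatrix'_toLin' (A * Q)
  rw [Matrix.toLin'_apply'] at hAQ
  rw [Matrix.mul_assoc, ← hAQ, ← LinearMap.toMatrix'_comp, hg, LinearMap.toMatrix'_id]

/-- The rank of a matrix over a domain does not increase under specialization. -/
theorem Matrix.rank_map_le_rank_map {R k L m n : Type*} [CommRing R] [Field k] [Field L]
    [Fintype m] [Fintype n] (ψ : R →+* k) (hψ : Function.Surjective ψ) (φ : R →+* L)
    (hφ : Function.Injective φ) (A : Matrix m n R) :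
    (A.map ψ).rank ≤ (A.map φ).rank := by
  obtain ⟨P, Q, hPQ⟩ := (A.map ψ).exists_mul_mul_eq_one
  -- Arbitrary lifts suffice: the determinant of the lifted product maps to `1` under `ψ`, so it is
  -- non-zero in `R`, hence also in `L`.
  let P' := P.map (Function.surjInv hψ)
  let Q' := Q.map (Function.surjInv hψ)
  have hP : P'.map ψ = P := by ext i j; simp [P', Function.surjInv_eq hψ]
  have hQ : Q'.map ψ = Q := by ext i j; simp [Q', Function.surjInv_eq hψ]
  have hdet : ψ (P' * A * Q').det = 1 := by
    rw [RingHom.map_det, RingHom.mapMatrix_apply, Matrix.map_mul, Matrix.map_mul, hP, hQ, hPQ,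
      Matrix.det_one]
  have hne : ((P' * A * Q').map φ).det ≠ 0 := by
    rw [← RingHom.mapMatrix_apply, ← RingHom.map_det]
    intro h0
    rw [(map_eq_zero_iff φ hφ).1 h0, map_zero] at hdet
    exact zero_ne_one hdet
  calc (A.map ψ).rank = ((P' * A * Q').map φ).rank := by
        rw [Matrix.rank_of_det_ne_zero hne, Fintype.card_fin]
    _ ≤ (A.map φ).rank := by
        rw [Matrix.map_mul, Matrix.map_mul]
        exact (Matrix.rank_mul_le_left _ _).trans (Matrix.rank_mul_le_right _ _)

theorem Matrix.card_le_rank_of_submatrix_eq_one {k m n r : Type*} [Field k] [Fintype n]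
    [Fintype r] [DecidableEq r] (A : Matrix m n k) (f : r → m) (g : r → n)
    (h : A.submatrix f g = 1) : Fintype.card r ≤ A.rank := by
  calc Fintype.card r = (A.submatrix f g).rank := by rw [h, Matrix.rank_one]
    _ ≤ A.rank := Matrix.rank_submatrix_le A f g

/-! ### Macaulay and Koszul matrices -/

/-- The exponents `m` of monomials with `deg m + a ≤ D`. -/
abbrev BoundedExponent (n a D : ℕ) : Type := {m : Fin n →₀ ℕ // m.degree + a ≤ D}

noncomputable instance (n a D : ℕ) : Fintype (BoundedExponent n a D) :=
  ((Finsupp.finite_of_degree_le (σ := Fin n) D).subset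
    (fun m (hm : m.degree + a ≤ D) => le_trans (Nat.le_add_right _ _) hm)).fintype

section Macaulay

variable {R : Type*} [CommRing R] {n : ℕ} {ι : Type*}

/-- The coefficient matrix of the products of degree at most `D` of a monomial with one of the
polynomials `g i` of degree at most `d`. -/
noncomputable def macaulayMatrix (g : ι → MvPolynomial (Fin n) R) (d D : ℕ) :
    Matrix (ι × BoundedExponent n d D) (BoundedExponent n 0 D) R :=
  fun p m => coeff m.1 (monomial p.2.1 1 * g p.1)

open scoped Classical in
/-- The matrix of the Koszul syzygies between the rows of the Macaulay matrix. -/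
noncomputable def koszulMatrix (g : ι → MvPolynomial (Fin n) R) (d D : ℕ) :
    Matrix ((ι × ι) × BoundedExponent n (2 * d) D) (ι × BoundedExponent n d D) R :=
  fun q p => (if p.1 = q.1.2 then coeff p.2.1 (monomial q.2.1 1 * g q.1.1) else 0) -
    (if p.1 = q.1.1 then coeff p.2.1 (monomial q.2.1 1 * g q.1.2) else 0)

theorem macaulayMatrix_map {S : Type*} [CommRing S] (φ : R →+* S)
    (g : ι → MvPolynomial (Fin n) R) (d D : ℕ) :
    (macaulayMatrix g d D).map φ = macaulayMatrix (fun i => map φ (g i)) d D := by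
  ext p m
  simp [macaulayMatrix, ← coeff_map]

theorem koszulMatrix_map {S : Type*} [CommRing S] (φ : R →+* S)
    (g : ι → MvPolynomial (Fin n) R) (d D : ℕ) :
    (koszulMatrix g d D).map φ = koszulMatrix (fun i => map φ (g i)) d D := by
  ext q p
  simp only [koszulMatrix, Matrix.map_apply, map_sub, apply_ite φ, map_zero, ← coeff_map, map_mul,
    map_monomial, map_one]

theorem sum_coeff_mul_coeff_monomial_mul {a D : ℕ} (p q : MvPolynomial (Fin n) R)
    (hp : ∀ m ∈ p.support, m.degree + a ≤ D) (l : Fin n →₀ ℕ) :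
    ∑ m : BoundedExponent n a D, coeff m.1 p * coeff l (monomial m.1 1 * q) = coeff l (p * q) := by
  have hsum : p = ∑ m : BoundedExponent n a D, monomial m.1 (coeff m.1 p) := by
    ext l
    rw [coeff_sum]
    simp only [coeff_monomial]
    by_cases hl : l.degree + a ≤ D
    · rw [Finset.sum_eq_single ⟨l, hl⟩]
      · simp
      · intro b _ hb
        rw [if_neg fun h => hb (Subtype.ext h)]
      · simp
    · rw [Finset.sum_eq_zero, notMem_support_iff.1 fun h => hl (hp l h)]
      intro b _
      rw [if_neg]
      rintro rfl
      exact hl b.2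
  conv_rhs => rw [hsum]
  rw [Finset.sum_mul, coeff_sum]
  refine Finset.sum_congr rfl fun m _ => ?_
  rw [← mul_one (coeff m.1 p), ← C_mul_monomial, mul_one, mul_assoc, coeff_C_mul]

theorem degree_add_le_of_mem_support_monomial_mul {d D : ℕ} {m : Fin n →₀ ℕ}
    (hm : m.degree + 2 * d ≤ D) {p : MvPolynomial (Fin n) R} (hp : ∀ l ∈ p.support, l.degree ≤ d)
    (l : Fin n →₀ ℕ) (hl : l ∈ (monomial m 1 * p).support) : l.degree + d ≤ D := by
  classical
  obtain ⟨x, hx, y, hy, rfl⟩ := Finset.mem_add.1 (support_mul _ _ hl)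
  have hxm := Finset.mem_singleton.1 (support_monomial_subset hx)
  have := hp y hy
  subst hxm
  rw [map_add]
  omega

/-- Row `((i, j), m)` encodes the syzygy `(x^m g_i) g_j - (x^m g_j) g_i = 0`; the bound `deg m + 2d
≤ D` keeps both multipliers among the row indices of the Macaulay matrix. -/
theorem koszulMatrix_mul_macaulayMatrix [Fintype ι] {d : ℕ} (D : ℕ)
    (g : ι → MvPolynomial (Fin n) R) (hg : ∀ i, ∀ m ∈ (g i).support, m.degree ≤ d) :
    koszulMatrix g d D * macaulayMatrix g d D = 0 := by
  classical
  ext q l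
  obtain ⟨⟨i, j⟩, m, hm⟩ := q
  have key : ∀ i j : ι, ∑ p : ι × BoundedExponent n d D,
      (if p.1 = j then coeff p.2.1 (monomial m 1 * g i) else 0) * macaulayMatrix g d D p l
        = coeff l.1 (monomial m 1 * g i * g j) := by
    intro i j
    rw [Fintype.sum_prod_type, Finset.sum_eq_single j]
    · simp only [if_true, macaulayMatrix]
      exact sum_coeff_mul_coeff_monomial_mul _ _
        (degree_add_le_of_mem_support_monomial_mul hm (hg i)) _
    · intro b _ hb
      simp [hb]
    · simp
  simp only [Matrix.mul_apply, Matrix.zero_apply, koszulMatrix, sub_mul, Finset.sum_sub_distrib]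
  rw [sub_eq_zero]
  convert (key i j).trans ((congrArg (coeff l.1) (mul_right_comm _ _ _)).trans (key j i).symm)
    using 1

end Macaulay

/-! ### Dimensions as matrix ranks -/

section Span

variable {K : Type*} [Field K] {n : ℕ}

/-- The polynomial with given coefficients in degrees at most `D`. -/
noncomputable def polynomialOfCoeffs (K : Type*) [Field K] (n D : ℕ) :
    (BoundedExponent n 0 D → K) →ₗ[K] MvPolynomial (Fin n) K :=
  Fintype.linearCombination K fun m : BoundedExponent n 0 D => monomial m.1 (1 : K)

theorem coeff_polynomialOfCoeffs {D : ℕ} (v : BoundedExponent n 0 D → K)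
    (m : BoundedExponent n 0 D) : coeff m.1 (polynomialOfCoeffs K n D v) = v m := by
  rw [polynomialOfCoeffs, Fintype.linearCombination_apply, coeff_sum, Finset.sum_eq_single m]
  · simp
  · intro b _ hb
    rw [coeff_smul, coeff_monomial, if_neg fun h => hb (Subtype.ext h), smul_zero]
  · simp

theorem polynomialOfCoeffs_injective (D : ℕ) : Function.Injective (polynomialOfCoeffs K n D) := by
  intro v w h
  funext m
  rw [← coeff_polynomialOfCoeffs v, h, coeff_polynomialOfCoeffs]

theorem polynomialOfCoeffs_coeff {D : ℕ} {p : MvPolynomial (Fin n) K}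
    (hp : ∀ m ∈ p.support, m.degree ≤ D) :
    polynomialOfCoeffs K n D (fun m => coeff m.1 p) = p := by
  ext l
  by_cases hl : l.degree ≤ D
  · exact coeff_polynomialOfCoeffs _ ⟨l, hl⟩
  · rw [notMem_support_iff.1 fun h => hl (hp l h), polynomialOfCoeffs,
      Fintype.linearCombination_apply, coeff_sum, Finset.sum_eq_zero]
    intro b _
    rw [coeff_smul, coeff_monomial, if_neg, smul_zero]
    rintro rfl
    exact hl b.2

theorem degree_le_of_mem_support {p : MvPolynomial (Fin n) K} {m : Fin n →₀ ℕ}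
    (hm : m ∈ p.support) : m.degree ≤ p.totalDegree :=
  le_totalDegree hm

theorem finrank_restrictTotalDegree (D : ℕ) :
    Module.finrank K (restrictTotalDegree (Fin n) K D) = Fintype.card (BoundedExponent n 0 D) := by
  have h : restrictTotalDegree (Fin n) K D = LinearMap.range (polynomialOfCoeffs K n D) := by
    ext p
    rw [mem_restrictTotalDegree]
    constructor
    · intro hp
      exact ⟨_, polynomialOfCoeffs_coeff fun m hm => (degree_le_of_mem_support hm).trans hp⟩
    · rintro ⟨v, rfl⟩
      rw [← mem_restrictTotalDegree, polynomialOfCoeffs, Fintype.linearCombination_apply]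
      refine Submodule.sum_mem _ fun m _ => Submodule.smul_mem _ _ ?_
      rw [mem_restrictTotalDegree]
      exact (totalDegree_monomial_le _ _).trans m.2
  rw [h, LinearMap.finrank_range_of_inj (polynomialOfCoeffs_injective D),
    Module.finrank_fintype_fun_eq_card]

theorem finrank_xlSpace {ι : Type*} [Fintype ι] {d : ℕ} (f : ι → MvPolynomial (Fin n) K)
    (hf : ∀ i, (f i).totalDegree = d) (D : ℕ) :
    Module.finrank K (xlSpace f D) = (macaulayMatrix f d D).rank := by
  have hrow : ∀ p : ι × BoundedExponent n d D,
      polynomialOfCoeffs K n D (macaulayMatrix f d D p) = monomial p.2.1 1 * f p.1 := by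
    intro p
    refine polynomialOfCoeffs_coeff fun m hm => (degree_le_of_mem_support hm).trans ?_
    refine (totalDegree_mul _ _).trans ?_
    rw [hf]
    exact (Nat.add_le_add_right (totalDegree_monomial_le _ _) d).trans p.2.2
  have h : xlSpace f D = (Submodule.span K (Set.range (macaulayMatrix f d D).row)).map
      (polynomialOfCoeffs K n D) := by
    rw [Submodule.map_span, ← Set.range_comp, xlSpace]
    congr 1
    ext p
    constructor
    · rintro ⟨i, m, hm, rfl⟩
      rw [hf] at hm
      exact ⟨(i, ⟨m, hm⟩), hrow _⟩
    · rintro ⟨⟨i, m⟩, rfl⟩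
      exact ⟨i, m.1, by rw [hf]; exact m.2, hrow _⟩
  rw [h, Matrix.rank_eq_finrank_span_row]
  exact (LinearEquiv.finrank_eq
    (Submodule.equivMapOfInjective _ (polynomialOfCoeffs_injective D) _)).symm

end Span

/-! ### The system of powers -/

section Monomial

variable {n : ℕ}

/-- The exponents of `1, x_1 ^ d, …, x_n ^ d`. -/
noncomputable def powerExponent (n d : ℕ) : Fin (n + 1) → Fin n →₀ ℕ :=
  Fin.cons 0 fun j => Finsupp.single j d

@[simp] theorem powerExponent_zero (d : ℕ) : powerExponent n d 0 = 0 := rfl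

@[simp] theorem powerExponent_succ (d : ℕ) (j : Fin n) :
    powerExponent n d j.succ = Finsupp.single j d := rfl

theorem degree_powerExponent_le (d : ℕ) (i : Fin (n + 1)) : (powerExponent n d i).degree ≤ d := by
  refine Fin.cases ?_ (fun j => ?_) i
  · simp
  · simp

/-- The system `1, x_1 ^ d, …, x_n ^ d`. -/
noncomputable def powerSystem (R : Type*) [CommRing R] (n d : ℕ) :
    Fin (n + 1) → MvPolynomial (Fin n) R :=
  fun i => monomial (powerExponent n d i) 1

/-- The exponent of the product of a monomial with a member of the power system. -/
noncomputable def powerProduct (n d D : ℕ) (p : Fin (n + 1) × BoundedExponent n d D) :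
    BoundedExponent n 0 D :=
  ⟨p.2.1 + powerExponent n d p.1, by
    rw [map_add]
    exact (Nat.add_le_add_left (degree_powerExponent_le d p.1) _).trans p.2.2⟩

/-- The powers are pairwise coprime, so each coincidence of two products is a Koszul syzygy. If one
power is `1`, the bound on `l` comes from the multiplier of larger degree. -/
theorem exists_common_divisor {d D : ℕ} {i i' : Fin (n + 1)} (hii : i ≠ i') {m m' : Fin n →₀ ℕ}
    (hm : m.degree + d ≤ D) (hm' : m'.degree + d ≤ D)
    (h : m + powerExponent n d i = m' + powerExponent n d i') :
    ∃ l : BoundedExponent n (2 * d) D,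
      l.1 + powerExponent n d i' = m ∧ l.1 + powerExponent n d i = m' := by
  have hdeg := congrArg Finsupp.degree h
  simp only [map_add] at hdeg
  induction i using Fin.cases with
  | zero =>
    induction i' using Fin.cases with
    | zero => exact absurd rfl hii
    | succ j =>
      simp only [powerExponent_zero, powerExponent_succ, add_zero, map_zero,
        Finsupp.degree_single] at h hdeg ⊢
      exact ⟨⟨m', by omega⟩, h.symm, rfl⟩
  | succ j =>
    induction i' using Fin.cases with
    | zero =>
      simp only [powerExponent_zero, powerExponent_succ, add_zero, map_zero,
        Finsupp.degree_single] at h hdeg ⊢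
      exact ⟨⟨m, by omega⟩, rfl, h⟩
    | succ j' =>
      simp only [powerExponent_succ] at h ⊢
      have hj : j ≠ j' := fun h => hii (congrArg _ h)
      have hle : Finsupp.single j' d ≤ m := by
        rw [Finsupp.single_le_iff]
        have := DFunLike.congr_fun h j'
        simp only [Finsupp.add_apply, Finsupp.single_eq_same, Finsupp.single_eq_of_ne hj.symm] at this
        omega
      obtain ⟨l, rfl⟩ := exists_add_of_le hle
      refine ⟨⟨l, ?_⟩, add_comm _ _, ?_⟩
      · rw [map_add, Finsupp.degree_single] at hm
        omega
      · rw [add_assoc, add_comm] at h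
        exact add_right_cancel h

variable (k : Type*) [Field k]

/-- One chosen row for each monomial attained gives an identity submatrix. -/
theorem card_range_powerProduct_le_rank (n d D : ℕ) :
    Nat.card (Set.range (powerProduct n d D)) ≤
      (macaulayMatrix (powerSystem k n d) d D).rank := by
  classical
  rw [Nat.card_eq_fintype_card]
  refine Matrix.card_le_rank_of_submatrix_eq_one _ (Set.rangeSplitting (powerProduct n d D))
    Subtype.val ?_
  ext r c
  have hr : (Set.rangeSplitting (powerProduct n d D) r).2.1 +
      powerExponent n d (Set.rangeSplitting (powerProduct n d D) r).1 = r.1.1 :=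
    congrArg Subtype.val (Set.apply_rangeSplitting (powerProduct n d D) r)
  simp only [Matrix.submatrix_apply, macaulayMatrix, powerSystem, monomial_mul, hr, mul_one,
    coeff_monomial, Matrix.one_apply, Subtype.ext_iff]

/-- Choose one row for each product. Each row not chosen has a Koszul relation with the chosen row
of the same product: entry `1` at the former, `-1` at the latter. Restricted to the columns not
chosen, these relations form an identity matrix. -/
theorem card_le_rank_koszulMatrix (n d D : ℕ) :
    Fintype.card (Fin (n + 1) × BoundedExponent n d D) ≤
      (koszulMatrix (powerSystem k n d) d D).rank + Nat.card (Set.range (powerProduct n d D)) := by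
  classical
  set s := Set.rangeSplitting (powerProduct n d D) with hs
  have hcard : Fintype.card {p // p ∉ Set.range s} + Nat.card (Set.range (powerProduct n d D)) =
      Fintype.card (Fin (n + 1) × BoundedExponent n d D) := by
    rw [Nat.card_eq_fintype_card,
      ← Set.card_range_of_injective (Set.rangeSplitting_injective (powerProduct n d D)),
      Fintype.card_subtype_compl]
    have := Fintype.card_subtype_le (· ∈ Set.range s)
    exact Nat.sub_add_cancel this
  rw [← hcard]
  refine Nat.add_le_add_right ?_ _
  have hex : ∀ p : {p // p ∉ Set.range s}, ∃ (i' : Fin (n + 1)) (l : BoundedExponent n (2 * d) D),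
      p.1.1 ≠ i' ∧ l.1 + powerExponent n d i' = p.1.2.1 ∧
      ∀ q : Fin (n + 1) × BoundedExponent n d D, q.1 = i' →
        l.1 + powerExponent n d p.1.1 = q.2.1 → q ∈ Set.range s := by
    rintro ⟨p, hp⟩
    let t := s ⟨powerProduct n d D p, p, rfl⟩
    have ht : powerProduct n d D t = powerProduct n d D p :=
      Set.apply_rangeSplitting (powerProduct n d D) _
    have ht' : p.2.1 + powerExponent n d p.1 = t.2.1 + powerExponent n d t.1 :=
      (congrArg Subtype.val ht).symm
    have hne : p.1 ≠ t.1 := by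
      intro h
      rw [h] at ht'
      exact hp ⟨_, (Prod.ext h (Subtype.ext (add_right_cancel ht')) : p = t).symm⟩
    obtain ⟨l, hl, hl'⟩ := exists_common_divisor hne p.2.2 t.2.2 ht'
    refine ⟨t.1, l, hne, hl, fun q hq hq' => ⟨_, (Prod.ext hq ?_ : q = t).symm⟩⟩
    exact Subtype.ext (hq'.symm.trans hl')
  choose i' l hne hl hmem using hex
  refine Matrix.card_le_rank_of_submatrix_eq_one _ (fun p => ((i' p, p.1.1), l p)) Subtype.val ?_
  ext p q
  simp only [Matrix.submatrix_apply, koszulMatrix, powerSystem, monomial_mul, mul_one,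
    coeff_monomial, Matrix.one_apply, hl]
  have h2 : (if q.1.1 = i' p then
      (if (l p).1 + powerExponent n d p.1.1 = q.1.2.1 then (1 : k) else 0) else 0) = 0 := by
    split_ifs with h1 h2
    · exact absurd (hmem p q.1 h1 h2) q.2
    · rfl
    · rfl
  rw [h2, sub_zero, ← ite_and]
  refine if_congr ?_ rfl rfl
  rw [Subtype.ext_iff, Prod.ext_iff, Subtype.ext_iff, eq_comm (a := q.1.1)]

theorem mem_range_powerProduct_iff {d D : ℕ} (m : BoundedExponent n 0 D) :
    m ∈ Set.range (powerProduct n d D) ↔ m.1.degree + d ≤ D ∨ ∃ j, d ≤ m.1 j := by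
  constructor
  · rintro ⟨⟨i, l⟩, rfl⟩
    induction i using Fin.cases with
    | zero => exact Or.inl (by simpa [powerProduct] using l.2)
    | succ j => exact Or.inr ⟨j, by simp [powerProduct]⟩
  · rintro (h | ⟨j, hj⟩)
    · exact ⟨(0, ⟨m.1, h⟩), Subtype.ext (by simp [powerProduct])⟩
    · obtain ⟨l, hl⟩ := exists_add_of_le (Finsupp.single_le_iff.2 hj)
      have hm := m.2
      rw [hl, map_add, Finsupp.degree_single] at hm
      exact ⟨(j.succ, ⟨l, by omega⟩), Subtype.ext (by simp [powerProduct, hl, add_comm])⟩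

end Monomial

/-! ### Counting the missed monomials -/

theorem ordinaryMultinomial_eq_card (N D : ℕ) {d : ℕ} (hd : 1 ≤ d) :
    ordinaryMultinomial N D (d - 1) =
      ((Fintype.piFinset fun _ : Fin N => Finset.range d).filter fun w => ∑ i, w i = D).card := by
  rw [ordinaryMultinomial, Nat.sub_add_cancel hd, ← Fin.prod_const, Finset.prod_univ_sum,
    Polynomial.finsetSum_coeff, Finset.card_filter]
  refine Finset.sum_congr rfl fun w _ => ?_
  rw [Finset.prod_pow_eq_pow_sum, Polynomial.coeff_X_pow]
  simp only [eq_comm]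

/-- Homogenizing to degree `D` adds the exponent `D - deg m` of `x_0`, and being missed means that
all `n + 1` exponents are below `d`. -/
theorem card_compl_range_powerProduct (n D : ℕ) {d : ℕ} (hd : 1 ≤ d) :
    Nat.card ↥(Set.range (powerProduct n d D))ᶜ = ordinaryMultinomial (n + 1) D (d - 1) := by
  have hmem : ∀ m : ↥(Set.range (powerProduct n d D))ᶜ,
      D < m.1.1.degree + d ∧ ∀ j, m.1.1 j < d := by
    intro m
    have := mt (mem_range_powerProduct_iff m.1).2 m.2
    push Not at this
    exact this
  let e : ↥(Set.range (powerProduct n d D))ᶜ →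
      {w // w ∈ (Fintype.piFinset fun _ : Fin (n + 1) => Finset.range d).filter
        fun w => ∑ i, w i = D} :=
    fun m => ⟨Fin.cons (D - m.1.1.degree) m.1.1, by
      have h1 : m.1.1.degree ≤ D := m.1.2
      obtain ⟨h2, h3⟩ := hmem m
      rw [Finset.mem_filter, Fintype.mem_piFinset, Fin.forall_fin_succ, Fin.sum_univ_succ]
      simp only [Fin.cons_zero, Fin.cons_succ, Finset.mem_range, ← Finsupp.degree_eq_sum]
      exact ⟨⟨by omega, h3⟩, by omega⟩⟩
  have he : Function.Bijective e := by
    constructor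
    · intro m m' h
      exact Subtype.ext (Subtype.ext (Finsupp.ext fun j =>
        congrFun (congrArg Subtype.val h) j.succ))
    · rintro ⟨w, hw⟩
      have hw' := hw
      rw [Finset.mem_filter, Fintype.mem_piFinset, Fin.forall_fin_succ, Fin.sum_univ_succ] at hw'
      simp only [Finset.mem_range] at hw'
      obtain ⟨⟨h0, hj⟩, hsum⟩ := hw'
      let m : Fin n →₀ ℕ := Finsupp.equivFunOnFinite.symm fun j => w j.succ
      have hdeg : m.degree = ∑ j : Fin n, w j.succ := Finsupp.degree_eq_sum m
      refine ⟨⟨⟨m, by omega⟩, fun h => ?_⟩, Subtype.ext ?_⟩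
      · rcases (mem_range_powerProduct_iff _).1 h with h | ⟨j, h⟩
        · have h' : m.degree + d ≤ D := h
          omega
        · exact absurd h (not_le.2 (hj j))
      · funext i
        induction i using Fin.cases with
        | zero =>
          change D - m.degree = w 0
          omega
        | succ j => rfl
  rw [ordinaryMultinomial_eq_card _ _ hd, Nat.card_eq_of_bijective e he, Nat.card_eq_fintype_card,
    Fintype.card_coe]

theorem card_range_powerProduct (n D : ℕ) {d : ℕ} (hd : 1 ≤ d) :
    Nat.card (Set.range (powerProduct n d D)) + ordinaryMultinomial (n + 1) D (d - 1) =
      Fintype.card (BoundedExponent n 0 D) := by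
  rw [← card_compl_range_powerProduct n D hd, ← Nat.card_eq_fintype_card]
  exact Set.ncard_add_ncard_compl _

/-! ### Comparison through the universal system -/

section Universal

variable (F : Type*) [Field F] (ι : Type*) (n d : ℕ)

/-- The system of polynomials of degree `d` with indeterminate coefficients. -/
noncomputable def universalSystem (i : ι) :
    MvPolynomial (Fin n) (MvPolynomial (ι × BoundedExponent n 0 d) F) :=
  ∑ m : BoundedExponent n 0 d, monomial m.1 (X (i, m))

variable {F ι n d}

theorem coeff_universalSystem (i : ι) (m : Fin n →₀ ℕ) :
    coeff m (universalSystem F ι n d i) =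
      if h : m.degree + 0 ≤ d then X (i, ⟨m, h⟩) else 0 := by
  rw [universalSystem, coeff_sum]
  split_ifs with h
  · rw [Finset.sum_eq_single ⟨m, h⟩]
    · simp
    · intro b _ hb
      rw [coeff_monomial, if_neg fun h => hb (Subtype.ext h)]
    · simp
  · refine Finset.sum_eq_zero fun b _ => ?_
    rw [coeff_monomial, if_neg]
    rintro rfl
    exact h b.2

theorem degree_le_of_mem_support_universalSystem (i : ι) (m : Fin n →₀ ℕ)
    (hm : m ∈ (universalSystem F ι n d i).support) : m.degree ≤ d := by
  rw [mem_support_iff, coeff_universalSystem] at hm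
  by_contra h
  exact hm (dif_neg h)

theorem map_universalSystem {L : Type*} [Field L] [Algebra F L] (g : ι → MvPolynomial (Fin n) L)
    (hg : ∀ i, ∀ m ∈ (g i).support, m.degree ≤ d) (i : ι) :
    map (aeval fun q : ι × BoundedExponent n 0 d => coeff q.2.1 (g q.1)).toRingHom
      (universalSystem F ι n d i) = g i := by
  ext m
  rw [coeff_map, coeff_universalSystem]
  split_ifs with h
  · simp
  · rw [map_zero, notMem_support_iff.1 fun hm => h (hg i m hm)]

theorem degree_le_of_mem_support_powerSystem (i : Fin (n + 1)) (m : Fin n →₀ ℕ)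
    (hm : m ∈ (powerSystem F n d i).support) : m.degree ≤ d := by
  rw [Finset.mem_singleton.1 (support_monomial_subset hm)]
  exact degree_powerExponent_le d i

theorem aeval_surjective {σ : Type*} (c : σ → F) :
    Function.Surjective (aeval c : MvPolynomial σ F →ₐ[F] F).toRingHom :=
  fun x => ⟨C x, by simp⟩

/-- The rank of the Macaulay matrix of any system of degree at most `d` is at most the one of the
system of powers. -/
theorem rank_macaulayMatrix_le (g : Fin (n + 1) → MvPolynomial (Fin n) F)
    (hg : ∀ i, ∀ m ∈ (g i).support, m.degree ≤ d) (D : ℕ) :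
    (macaulayMatrix g d D).rank ≤ Nat.card (Set.range (powerProduct n d D)) := by
  classical
  let U := universalSystem F (Fin (n + 1)) n d
  let φ := algebraMap (MvPolynomial (Fin (n + 1) × BoundedExponent n 0 d) F)
    (FractionRing (MvPolynomial (Fin (n + 1) × BoundedExponent n 0 d) F))
  have hφ : Function.Injective φ := IsFractionRing.injective _ _
  have hA := Matrix.rank_map_le_rank_map _
    (aeval_surjective fun q : Fin (n + 1) × BoundedExponent n 0 d => coeff q.2.1 (g q.1)) φ hφ
    (macaulayMatrix U d D)
  rw [macaulayMatrix_map, funext (map_universalSystem g hg)] at hA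
  -- Here the universal system is specialized to the powers instead of `g`, bounding the Koszul rank
  -- from below.
  have hB := Matrix.rank_map_le_rank_map _
    (aeval_surjective fun q : Fin (n + 1) × BoundedExponent n 0 d =>
      coeff q.2.1 (powerSystem F n d q.1)) φ hφ (koszulMatrix U d D)
  rw [koszulMatrix_map, funext (map_universalSystem _ degree_le_of_mem_support_powerSystem)] at hB
  have hBA : (koszulMatrix U d D).map φ * (macaulayMatrix U d D).map φ = 0 := by
    rw [← Matrix.map_mul, koszulMatrix_mul_macaulayMatrix D U
      degree_le_of_mem_support_universalSystem, Matrix.map_zero _ (map_zero φ)]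
  have hsum := Matrix.rank_add_rank_le_card_of_mul_eq_zero hBA
  have := card_le_rank_koszulMatrix F n d D
  omega

/-- A system whose coefficients are algebraically independent has a Macaulay matrix of at least
the rank of the one of the system of powers. -/
theorem le_rank_macaulayMatrix {L : Type*} [Field L] [Algebra F L]
    (g : Fin (n + 1) → MvPolynomial (Fin n) L) (hg : ∀ i, ∀ m ∈ (g i).support, m.degree ≤ d)
    (hind : AlgebraicIndependent F
      fun q : Fin (n + 1) × BoundedExponent n 0 d => coeff q.2.1 (g q.1)) (D : ℕ) :
    Nat.card (Set.range (powerProduct n d D)) ≤ (macaulayMatrix g d D).rank := by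
  refine (card_range_powerProduct_le_rank F n d D).trans ?_
  -- By `hind`, evaluation at the coefficients of `g` is injective, so `g` itself plays the
  -- universal system.
  have hA := Matrix.rank_map_le_rank_map _
    (aeval_surjective fun q : Fin (n + 1) × BoundedExponent n 0 d =>
      coeff q.2.1 (powerSystem F n d q.1))
    (aeval fun q : Fin (n + 1) × BoundedExponent n 0 d => coeff q.2.1 (g q.1)).toRingHom hind
    (macaulayMatrix (universalSystem F (Fin (n + 1)) n d) d D)
  rwa [macaulayMatrix_map, macaulayMatrix_map,
    funext (map_universalSystem _ degree_le_of_mem_support_powerSystem),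
    funext (map_universalSystem g hg)] at hA

end Universal

/-! ### Homogenization and the main theorem -/

theorem coeff_cons_homogenization {K : Type*} [Field K] {n : ℕ} (f : MvPolynomial (Fin n) K)
    (m : Fin n →₀ ℕ) :
    coeff (Finsupp.cons (f.totalDegree - m.degree) m) (homogenization f) = coeff m f := by
  rw [homogenization, coeff_sum]
  by_cases hm : m ∈ f.support
  · rw [Finset.sum_eq_single_of_mem m hm, coeff_monomial, if_pos rfl]
    intro b _ hb
    rw [coeff_monomial, if_neg fun h => hb (Finsupp.cons_injective2 h).2]
  · rw [notMem_support_iff.1 hm]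
    refine Finset.sum_eq_zero fun b hb => ?_
    rw [coeff_monomial, if_neg]
    intro h
    exact hm ((Finsupp.cons_injective2 h).2 ▸ hb)

theorem degree_cons {n : ℕ} (a : ℕ) (m : Fin n →₀ ℕ) :
    (Finsupp.cons a m).degree = a + m.degree := by
  simp [Finsupp.degree_eq_sum, Fin.sum_univ_succ]

theorem IsGenericSystem.algebraicIndependent_coeff {K : Type*} [Field K] {n d : ℕ} {ι : Type*}
    {f : ι → MvPolynomial (Fin n) K} (hf : ∀ i, (f i).totalDegree = d)
    (h : IsGenericSystem (fun _ => d) fun i => homogenization (f i)) :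
    AlgebraicIndependent (⊥ : Subfield K)
      fun q : ι × BoundedExponent n 0 d => coeff q.2.1 (f q.1) := by
  let e : ι × BoundedExponent n 0 d → Σ _ : ι, {m : Fin (n + 1) →₀ ℕ // m.degree = d} :=
    fun q => ⟨q.1, Finsupp.cons (d - q.2.1.degree) q.2.1, by
      rw [degree_cons]
      exact Nat.sub_add_cancel q.2.2⟩
  have he : Function.Injective e := by
    rintro ⟨i, m⟩ ⟨i', m'⟩ hq
    obtain ⟨rfl, hq⟩ := Sigma.mk.inj_iff.1 hq
    have hq' := congrArg Subtype.val (eq_of_heq hq)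
    exact Prod.ext rfl (Subtype.ext (Finsupp.cons_injective2 hq').2)
  convert h.algebraicIndependent.comp e he using 1
  funext q
  have := coeff_cons_homogenization (f q.1) q.2.1
  rw [hf] at this
  exact this.symm

theorem mainTheorem5 {K : Type*} [Field K] (n d : ℕ) (hd : 1 ≤ d)
    (f : Fin (n + 1) → MvPolynomial (Fin n) K) (hf : ∀ i, (f i).totalDegree = d) :
    (∀ D : ℕ, (ordinaryMultinomial (n + 1) D (d - 1) : ℤ) ≤ xlDefect f D) ∧
    (IsGenericSystem (fun _ => d) (fun i => homogenization (f i)) →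
      ∀ D : ℕ, xlDefect f D = (ordinaryMultinomial (n + 1) D (d - 1) : ℤ)) := by
  have hsupp : ∀ i, ∀ m ∈ (f i).support, m.degree ≤ d := fun i m hm =>
    hf i ▸ degree_le_of_mem_support hm
  refine ⟨fun D => ?_, fun hgen D => ?_⟩
  · have := rank_macaulayMatrix_le f hsupp D
    have := card_range_powerProduct n D hd
    rw [xlDefect, finrank_restrictTotalDegree, finrank_xlSpace f hf]
    omega
  · have := rank_macaulayMatrix_le f hsupp D
    have := le_rank_macaulayMatrix f hsupp (hgen.algebraicIndependent_coeff hf) D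
    have := card_range_powerProduct n D hd
    rw [xlDefect, finrank_restrictTotalDegree, finrank_xlSpace f hf]
    omega
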